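/- Let $p$ be a prime number and let $Y$ be a normal integral scheme of characteristic $p$ (i.e. $p=0$ in $\mathcal{O}_Y$). Write $F_Y:Y\to Y$ for the absolute Frobenius endomorphism, $\Omega_{F_Y}$ for the sheaf of relative differentials of $F_Y$, and $\kappa(Y)$ for the function field of $Y$. For an $\mathcal{O}_Y$-module $M$ with generic fibre $M_{\kappa(Y)}$ put $$\Gamma(Y,M)_g:=\{e\in M_{\kappa(Y)}\mid \exists\,\sigma\in\Gamma(Y,M):\ \sigma_{\kappa(Y)}=e\}.$$ Let $W$ be a vector bundle (a locally free $\mathcal{O}_Y$-module of finite rank) on $Y$. If $\Gamma(Y,\Omega_{F_Y}\otimes F_Y^*W)_g=0$, then the natural Frobenius pull-back map of abelian groups $H^1(Y,W)\to H^1(Y,F_Y^*W)$ is injective. -/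

import Mathlib

open CategoryTheory AlgebraicGeometry TopologicalSpace Opposite

universe u

noncomputable section

namespace FrobeniusH1

/-- A scheme is normal if all its local rings are integrally closed domains. -/
def IsNormal (Y : Scheme.{u}) : Prop :=
  ∀ y : Y, IsDomain (Y.presheaf.stalk y) ∧ IsIntegrallyClosed (Y.presheaf.stalk y)

/-- A vector bundle: an `𝒪_Y`-module which is locally free of finite rank. -/
def IsVectorBundle {Y : Scheme.{u}} (W : Y.Modules) : Prop :=
  ∀ y : Y, ∃ U : Y.Opens, y ∈ U ∧ ∃ n : ℕ,
    Nonempty ((W.restrict U.ι : (U : Scheme.{u}).Modules) ≅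
      (SheafOfModules.free (R := (U : Scheme.{u}).ringCatSheaf) (ULift.{u} (Fin n)) :
        SheafOfModules.{u} (U : Scheme.{u}).ringCatSheaf))

/-- The sheaf of modules associated with a presheaf of modules over `𝒪_X`. -/
def sheafify {X : Scheme.{u}} (P : X.PresheafOfModules) : X.Modules :=
  (PresheafOfModules.sheafification (𝟙 X.ringCatSheaf.obj)).obj P

/-- The tensor product of `𝒪_X`-modules: the sheaf associated with
`U ↦ M(U) ⊗ N(U)`, the tensor product being over `𝒪_X(U)`. -/
def tensor {X : Scheme.{u}} (M N : X.Modules) : X.Modules :=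
  sheafify (PresheafOfModules.Monoidal.tensorObj (R := X.presheaf) M.val N.val)

/-- The morphism of presheaves of rings `f⁻¹ 𝒪_Y ⟶ 𝒪_X` on `X` attached to a morphism of schemes
`f : X ⟶ Y`, where `f⁻¹` is the inverse image of presheaves. -/
def inverseImageHom {X Y : Scheme.{u}} (f : X ⟶ Y) :
    (TopCat.Presheaf.pullback CommRingCat.{u} f.base).obj Y.presheaf ⟶ X.presheaf :=
  ((TopCat.Presheaf.pullbackPushforwardAdjunction CommRingCat.{u} f.base).homEquiv
    Y.presheaf X.presheaf).symm f.c

/-- The sheaf of relative differentials `Ω_f` of a morphism of schemes `f : X ⟶ Y`: the sheaf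
associated with the presheaf sending `U` to the Kähler differentials of `𝒪_X(U)` over
`(f⁻¹ 𝒪_Y)(U)`. -/
def relativeDifferentials {X Y : Scheme.{u}} (f : X ⟶ Y) : X.Modules :=
  sheafify (PresheafOfModules.DifferentialsConstruction.relativeDifferentials' (inverseImageHom f))

/-- The group of generic global sections of an `𝒪_Y`-module `M` on an integral scheme `Y`: the
elements of the fibre of `M` at the generic point that come from a global section of `M`.
(As the local ring at the generic point is the function field of `Y`, the fibre is the stalk.) -/
def genericGlobalSections {Y : Scheme.{u}} [IsIntegral Y] (M : Y.Modules) :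
    AddSubgroup (M.presheaf.stalk (genericPoint Y)) :=
  (M.presheaf.germ ⊤ (genericPoint Y) trivial).hom.range

/-- The cohomology group `H^n(Y, M)` of (the abelian sheaf underlying) an `𝒪_Y`-module. -/
abbrev H {Y : Scheme.{u}} (M : Y.Modules) (n : ℕ) : Type u :=
  Sheaf.H.{u} ((SheafOfModules.toSheaf Y.ringCatSheaf).obj M) n

lemma natCast_eq_zero (p : ℕ) (Y : Scheme.{u}) [CharP Γ(Y, ⊤) p]
    (U : Y.Opensᵒᵖ) : (p : Y.presheaf.obj U) = 0 := by
  have h : (p : Γ(Y, ⊤)) = 0 := CharP.cast_eq_zero _ p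
  have := congrArg (Y.presheaf.map (homOfLE (le_top (a := U.unop))).op).hom h
  rw [map_natCast, map_zero] at this
  exact this

section Frobenius

variable (p : ℕ) [Fact p.Prime]

/-- The Frobenius endomorphism `x ↦ x ^ p` of a commutative ring in which `p = 0`. -/
def ringFrobenius (R : Type u) [CommRing R] (h : (p : R) = 0) : R →+* R where
  toFun x := x ^ p
  map_one' := one_pow p
  map_mul' x y := mul_pow x y p
  map_zero' := zero_pow (Fact.out : p.Prime).ne_zero
  map_add' x y := by
    obtain ⟨r, hr⟩ := (Commute.all x y).exists_add_pow_prime_eq (Fact.out : p.Prime)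
    simp [hr, h]

variable (Y : Scheme.{u}) [CharP Γ(Y, ⊤) p]

/-- The Frobenius endomorphism of the structure sheaf of a scheme of characteristic `p`. -/
def presheafFrobenius : Y.presheaf ⟶ Y.presheaf where
  app U := CommRingCat.ofHom (ringFrobenius p (Y.presheaf.obj U) (natCast_eq_zero p Y U))
  naturality U V i := by
    ext x
    exact (map_pow (Y.presheaf.map i).hom x p).symm

/-- The absolute Frobenius endomorphism as a morphism of presheafed spaces: the identity on
the underlying space and `s ↦ s ^ p` on sections. -/
def presheafedSpaceFrobenius : Y.toPresheafedSpace ⟶ Y.toPresheafedSpace where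
  base := 𝟙 _
  c := presheafFrobenius p Y

/-- The absolute Frobenius endomorphism `F_Y` of a scheme `Y` of characteristic `p`. -/
def absoluteFrobenius : Y ⟶ Y where
  toHom := presheafedSpaceFrobenius p Y
  prop y := by
    refine ⟨fun a ha => ?_⟩
    obtain ⟨U, hU, s, rfl⟩ := Y.presheaf.exists_germ_eq (x := y) a
    have h : ((presheafedSpaceFrobenius p Y).stalkMap y).hom (Y.presheaf.germ U y hU s) =
        (Y.presheaf.germ U y hU s) ^ p := by
      refine (PresheafedSpace.stalkMap_germ_apply (presheafedSpaceFrobenius p Y) U y hU s).trans ?_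
      exact map_pow (Y.presheaf.germ U y hU).hom s p
    exact (isUnit_pow_iff (Fact.out : p.Prime).ne_zero).mp (h ▸ ha)

/-- As `F_Y` is the identity on the underlying space of `Y`, the abelian sheaf underlying the
direct image `F_{Y,*} N` is the one underlying `N`. -/
def pushforwardFrobeniusIso (N : Y.Modules) :
    (SheafOfModules.toSheaf Y.ringCatSheaf).obj
        ((Scheme.Modules.pushforward (absoluteFrobenius p Y)).obj N) ≅
      (SheafOfModules.toSheaf Y.ringCatSheaf).obj N :=
  Iso.refl _

/-- The natural morphism of abelian sheaves `W ⟶ F_Y^* W`: the unit `W ⟶ F_{Y,*} F_Y^* W`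
of the adjunction between inverse and direct images, followed by the identification of
the abelian sheaves underlying `F_{Y,*} F_Y^* W` and `F_Y^* W`. -/
def toFrobeniusPullback (W : Y.Modules) :
    (SheafOfModules.toSheaf Y.ringCatSheaf).obj W ⟶
      (SheafOfModules.toSheaf Y.ringCatSheaf).obj
        ((Scheme.Modules.pullback (absoluteFrobenius p Y)).obj W) :=
  (SheafOfModules.toSheaf Y.ringCatSheaf).map
      ((Scheme.Modules.pullbackPushforwardAdjunction (absoluteFrobenius p Y)).unit.app W) ≫
    (pushforwardFrobeniusIso p Y _).hom

/-- The Frobenius pull-back map `H^n(Y, W) → H^n(Y, F_Y^* W)`. -/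
def frobeniusPullback (W : Y.Modules) (n : ℕ) :
    H W n →+ H ((Scheme.Modules.pullback (absoluteFrobenius p Y)).obj W) n :=
  Sheaf.H.map (toFrobeniusPullback p Y W) n

end Frobenius

end FrobeniusH1

end

/-! Let `B` be the cokernel of `W ⟶ F^*W` as abelian sheaves. This map is injective
(`frobUnit_injective`), so by the long exact sequence the kernel on `H^1` is a quotient of `Γ(Y,
B)`, and it suffices that `B` has no nonzero global section (`cokernel_section_eq_zero`).

The tool is the canonical connection on `F^*W`: if `e` is a local basis of `W`, then `F^*e` is a
basis of `F^*W` (`IsBasis.frobUnit`), and `∑ f_i F^*e_i` is sent to `∑ df_i ⊗ F^*e_i`. This is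
independent of the basis because transition coefficients are `p`-th powers, whose differentials
vanish (`sum_pairing_eq_zero`), and it kills the image of `W`. Local lifts of a section of `B`
therefore have derivatives that glue to a global section of `Ω_F ⊗ F^*W`, which vanishes at the
generic point by hypothesis.

Hence each `f_i` has zero differential generically. In a field of characteristic `p` this makes it a
`p`-th power (`exists_subfield_D_ne_zero`), and normality makes the root a local section of the
structure sheaf (`exists_germ_pow_eq`). Writing `f_i = g_i^p` gives `f_i F^*e_i = F^*(g_i e_i)`, so
the lift comes locally from `W` and the section of `B` is zero. -/

noncomputable section

namespace FrobeniusH1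

/-! ### Differentials and `p`-th powers in fields of characteristic `p` -/

section FieldTheory

open IntermediateField in
/-- An element of a field of characteristic `p` which is not a `p`-th power has a nonzero
differential over a suitable subfield containing all `p`-th powers. -/
theorem exists_subfield_D_ne_zero {K : Type u} [Field K] (p : ℕ) [hp : Fact p.Prime]
    (hK : (p : K) = 0) (x : K) (hx : ∀ y : K, y ^ p ≠ x) :
    ∃ E : Subfield K, (∀ y : K, y ^ p ∈ E) ∧ KaehlerDifferential.D E K x ≠ 0 := by
  have : CharP K p := (CharP.charP_iff_prime_eq_zero hp.out).mpr hK
  let S : Set (Subfield K) := {E | (∀ y : K, y ^ p ∈ E) ∧ x ∉ E}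
  have hfr : (frobenius K p).fieldRange ∈ S := by
    refine ⟨fun y => ⟨y, rfl⟩, ?_⟩
    rintro ⟨y, hy⟩
    exact hx y hy
  -- `E` is maximal among the subfields that contain all `p`-th powers but not `x`. The aim is `E(x)
  -- = K`, so that `D x = 0` would force every differential to vanish.
  obtain ⟨E, -, hE⟩ := zorn_le_nonempty₀ S (fun c hc hch E₀ hE₀ => by
    have hdir : DirectedOn (· ≤ ·) c := hch.directedOn
    refine ⟨sSup c, ⟨fun y => ?_, ?_⟩, fun z hz => le_sSup hz⟩
    · exact (le_sSup hE₀) ((hc hE₀).1 y)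
    · intro hmem
      rw [Subfield.mem_sSup_of_directedOn ⟨E₀, hE₀⟩ hdir] at hmem
      obtain ⟨s, hs, hxs⟩ := hmem
      exact (hc hs).2 hxs) _ hfr
  obtain ⟨⟨hpow, hxE⟩, hmax⟩ := hE
  refine ⟨E, hpow, fun hD => ?_⟩
  have hmem (y : K) (hy : y ∉ E) : x ∈ E⟮y⟯ := by
    by_contra hxy
    have hle : E ≤ (E⟮y⟯).toSubfield := fun z hz =>
      (E⟮y⟯).algebraMap_mem ⟨z, hz⟩
    have := hmax (y := (E⟮y⟯).toSubfield) ⟨fun z => hle (hpow z), hxy⟩ hle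
    exact hy (this (mem_adjoin_simple_self E y))
  have hint (y : K) : IsIntegral E y := by
    refine IsIntegral.of_pow hp.out.pos ?_
    exact isIntegral_algebraMap (R := E) (A := K) (x := ⟨y ^ p, hpow y⟩)
  -- `X ^ p - y ^ p` is irreducible over `E`: Frobenius is injective, so a `p`-th root of `y ^ p` in
  -- `E` would be `y`.
  have hrank (y : K) (hy : y ∉ E) : Module.finrank E E⟮y⟯ = p := by
    have hirr : Irreducible (Polynomial.X ^ p - Polynomial.C (⟨y ^ p, hpow y⟩ : E)) := by
      refine (X_pow_sub_C_irreducible_iff_of_prime hp.out).mpr fun b hb => hy ?_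
      have h1 : (b : K) ^ p = y ^ p := congrArg Subtype.val hb
      have : (b : K) = y := frobenius_inj K p h1
      exact this ▸ b.2
    have hmin := minpoly.eq_of_irreducible_of_monic (x := y) hirr
      (by simp [Algebra.algebraMap_ofSubsemiring_apply])
      (Polynomial.monic_X_pow_sub_C _ hp.out.ne_zero)
    rw [adjoin.finrank (hint y), ← hmin, Polynomial.natDegree_X_pow_sub_C]
  -- For `y` outside `E`, maximality gives `E(x) ≤ E(y)`, and both have degree `p`.
  have htop : E⟮x⟯ = ⊤ := by
    rw [eq_top_iff]
    intro y _
    by_cases hy : y ∈ E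
    · exact (E⟮x⟯).algebraMap_mem ⟨y, hy⟩
    · have hle : E⟮x⟯ ≤ E⟮y⟯ := adjoin_simple_le_iff.mpr (hmem y hy)
      have : FiniteDimensional E E⟮y⟯ := adjoin.finiteDimensional (hint y)
      rw [eq_of_le_of_finrank_eq hle ((hrank x hxE).trans (hrank y hy).symm)]
      exact mem_adjoin_simple_self E y
  have : FiniteDimensional E E⟮x⟯ := adjoin.finiteDimensional (hint x)
  have hfin : FiniteDimensional E K := by
    rw [htop] at this
    exact Module.Finite.equiv (IntermediateField.topEquiv (F := E) (E := K)).toLinearEquiv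
  have hD0 : ∀ y, KaehlerDifferential.D E K y = 0 := by
    have halg : Algebra.adjoin E {x} = ⊤ := by
      rw [← adjoin_simple_toSubalgebra_of_isAlgebraic (hint x).isAlgebraic, htop]
      rfl
    intro y
    have hy : y ∈ Algebra.adjoin E {x} := halg ▸ trivial
    induction hy using Algebra.adjoin_induction with
    | mem z hz => rw [Set.mem_singleton_iff.mp hz, hD]
    | algebraMap r => simp
    | add a b _ _ ha hb => simp [ha, hb]
    | mul a b _ _ ha hb => simp [ha, hb]
  have hunr : Algebra.FormallyUnramified E K := by
    refine ⟨?_⟩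
    rw [← Submodule.subsingleton_iff K, ← subsingleton_iff_bot_eq_top,
      ← KaehlerDifferential.span_range_derivation, eq_comm, Submodule.span_eq_bot]
    rintro _ ⟨y, rfl⟩
    exact hD0 y
  -- Zero differentials make `K / E` separable, yet it is purely inseparable; so `x` lies in `E`, a
  -- contradiction.
  have : Algebra.IsSeparable E K := (Algebra.FormallyUnramified.iff_isSeparable E K).mp hunr
  have hpi : IsPurelyInseparable E K := by
    have : ExpChar E p := by
      have : CharP E p := (CharP.charP_iff_prime_eq_zero hp.out).mpr (Subtype.ext (by simp))
      infer_instance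
    rw [isPurelyInseparable_iff_pow_mem E p]
    exact fun y => ⟨1, ⟨y ^ p, hpow y⟩, by simp; rfl⟩
  obtain ⟨z, hz⟩ := IsPurelyInseparable.inseparable E x (Algebra.IsSeparable.isSeparable E x)
  exact hxE (hz ▸ z.2)

end FieldTheory

/-! ### Local bases of vector bundles -/

section Bases

variable {Y : Scheme.{u}}

/-- The restriction maps of the structure sheaf. -/
def resO {V U : Y.Opens} (h : V ≤ U) : Γ(Y, U) →+* Γ(Y, V) :=
  (Y.presheaf.map (homOfLE h).op).hom

/-- The restriction maps of a sheaf of modules. -/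
def res (M : Y.Modules) {V U : Y.Opens} (h : V ≤ U) : Γ(M, U) →+ Γ(M, V) :=
  (M.presheaf.map (homOfLE h).op).hom

@[simp]
theorem resO_resO {U V V' : Y.Opens} (h : V ≤ U) (h' : V' ≤ V) (f : Γ(Y, U)) :
    resO h' (resO h f) = resO (h'.trans h) f :=
  (ConcreteCategory.congr_hom (Y.presheaf.map_comp (homOfLE h).op (homOfLE h').op) f).symm

@[simp]
theorem res_res (M : Y.Modules) {U V V' : Y.Opens} (h : V ≤ U) (h' : V' ≤ V) (m : Γ(M, U)) :
    res M h' (res M h m) = res M (h'.trans h) m :=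
  (ConcreteCategory.congr_hom (M.presheaf.map_comp (homOfLE h).op (homOfLE h').op) m).symm

@[simp]
theorem res_self (M : Y.Modules) {U : Y.Opens} (m : Γ(M, U)) : res M le_rfl m = m :=
  ConcreteCategory.congr_hom (M.presheaf.map_id (op U)) m

@[simp]
theorem resO_self {U : Y.Opens} (f : Γ(Y, U)) : resO le_rfl f = f :=
  ConcreteCategory.congr_hom (Y.presheaf.map_id (op U)) f

@[simp]
theorem res_smul (M : Y.Modules) {U V : Y.Opens} (h : V ≤ U) (f : Γ(Y, U)) (m : Γ(M, U)) :
    res M h (f • m) = resO h f • res M h m :=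
  M.map_smul (homOfLE h) f m

/-- A finite family of sections over `U` is a basis if over each smaller open subset every section
is uniquely a linear combination of it. -/
def IsBasis (M : Y.Modules) {U : Y.Opens} {n : ℕ} (e : Fin n → Γ(M, U)) : Prop :=
  ∀ (V : Y.Opens) (h : V ≤ U) (m : Γ(M, V)),
    ∃! f : Fin n → Γ(Y, V), ∑ i, f i • res M h (e i) = m

/-- The structure sheaf as a module over itself. -/
abbrev unitModule (X : Scheme.{u}) : X.Modules := SheafOfModules.unit X.ringCatSheaf

theorem app_res {M N : Y.Modules} (φ : M ⟶ N) {U V : Y.Opens} (h : V ≤ U) (m : Γ(M, U)) :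
    φ.app V (res M h m) = res N h (φ.app U m) :=
  ConcreteCategory.congr_hom (φ.mapPresheaf.naturality (homOfLE h).op) m

theorem sum_app {M N : Y.Modules} {ι : Type*} (s : Finset ι) (φ : ι → (M ⟶ N)) (U : Y.Opens)
    (m : Γ(M, U)) : (∑ i ∈ s, φ i).app U m = ∑ i ∈ s, (φ i).app U m := by
  classical
  induction s using Finset.induction_on with
  | empty => simp
  | insert a s ha ih =>
    rw [Finset.sum_insert ha, Finset.sum_insert ha, ← ih]
    rfl

/-- The section of the structure sheaf, viewed as a module, given by a function. -/
def toUnit {U : Y.Opens} (f : Γ(Y, U)) : Γ(unitModule Y, U) := f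

theorem app_toUnit {M : Y.Modules} (a : unitModule Y ⟶ M) {U V : Y.Opens} (h : V ≤ U)
    (r : Γ(Y, V)) : a.app V (toUnit r) = r • res M h (a.app U (toUnit 1)) := by
  rw [← app_res, ← Scheme.Modules.Hom.app_smul]
  refine congrArg (a.app V) ?_
  have h1 : res (unitModule Y) h (toUnit 1) = toUnit 1 :=
    map_one (Y.presheaf.map (homOfLE h).op).hom
  rw [h1]
  exact (mul_one r).symm

/-- The `a i` and `b i` exhibit `M` as a biproduct of copies of the structure sheaf. The basis
consists of the images of `1`, and the coordinates are the projections `b i`. -/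
theorem isBasis_of_projections (M : Y.Modules) {n : ℕ}
    (a : Fin n → (unitModule Y ⟶ M)) (b : Fin n → (M ⟶ unitModule Y))
    (hab : ∀ i, a i ≫ b i = 𝟙 _) (hab' : ∀ i j, i ≠ j → a i ≫ b j = 0)
    (hba : ∑ i, b i ≫ a i = 𝟙 _) :
    IsBasis M (fun i => (a i).app ⊤ (toUnit 1)) := by
  intro V h m
  simp only [← app_toUnit]
  refine ⟨fun i => (b i).app V m, ?_, fun f hf => funext fun j => ?_⟩
  · have := congrArg (fun φ : M ⟶ M => φ.app V m) hba
    dsimp only at this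
    rw [sum_app] at this
    exact this
  · rw [← hf, map_sum, Finset.sum_eq_single j]
    · exact (congrArg (fun φ : unitModule Y ⟶ unitModule Y => φ.app V (f j)) (hab j)).symm
    · intro i _ hij
      exact congrArg (fun φ : unitModule Y ⟶ unitModule Y => φ.app V (f i)) (hab' i j hij)
    · simp

theorem exists_isBasis_of_iso_free (M : Y.Modules) (n : ℕ)
    (φ : M ≅ (SheafOfModules.free (R := Y.ringCatSheaf) (ULift.{u} (Fin n)) :
        SheafOfModules.{u} Y.ringCatSheaf)) :
    ∃ e : Fin n → Γ(M, ⊤), IsBasis M e := by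
  classical
  let F : Y.Modules := SheafOfModules.free (R := Y.ringCatSheaf) (ULift.{u} (Fin n))
  let ψ : M ≅ F := φ
  let hc := SheafOfModules.isColimitFreeCofan (R := Y.ringCatSheaf) (ULift.{u} (Fin n))
  let ι (i : ULift.{u} (Fin n)) : unitModule Y ⟶ F := SheafOfModules.ιFree i
  let π (j : ULift.{u} (Fin n)) : F ⟶ unitModule Y :=
    Limits.Cofan.IsColimit.desc hc (fun i => if i = j then 𝟙 _ else 0)
  have hιπ (i j) : ι i ≫ π j = if i = j then 𝟙 _ else 0 :=
    Limits.Cofan.IsColimit.fac hc _ i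
  have hπι : ∑ i, π i ≫ ι i = 𝟙 F := by
    refine Limits.Cofan.IsColimit.hom_ext hc _ _ fun i => ?_
    change ι i ≫ _ = ι i ≫ 𝟙 F
    rw [Preadditive.comp_sum, Finset.sum_eq_single i]
    · rw [← Category.assoc, hιπ, if_pos rfl, Category.id_comp, Category.comp_id]
    · intro j _ hj
      rw [← Category.assoc, hιπ, if_neg (Ne.symm hj), Limits.zero_comp]
    · simp
  refine ⟨_, isBasis_of_projections M (fun i => ι ⟨i⟩ ≫ ψ.inv) (fun i => ψ.hom ≫ π ⟨i⟩) ?_ ?_ ?_⟩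
  · intro i
    have := hιπ ⟨i⟩ ⟨i⟩
    rw [Category.assoc, Iso.inv_hom_id_assoc, this, if_pos rfl]
  · intro i j hij
    rw [Category.assoc, Iso.inv_hom_id_assoc, hιπ, if_neg (by simpa using hij)]
  · have : ∑ i : Fin n, π ⟨i⟩ ≫ ι ⟨i⟩ = 𝟙 F := by
      rw [← hπι]
      exact Fintype.sum_equiv Equiv.ulift.symm _ _ fun _ => rfl
    calc ∑ i : Fin n, (ψ.hom ≫ π ⟨i⟩) ≫ ι ⟨i⟩ ≫ ψ.inv
        = ψ.hom ≫ (∑ i : Fin n, π ⟨i⟩ ≫ ι ⟨i⟩) ≫ ψ.inv := by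
          rw [Preadditive.sum_comp, Preadditive.comp_sum]
          exact Finset.sum_congr rfl fun i _ => by simp only [Category.assoc]
      _ = 𝟙 M := by
          rw [this]
          exact ψ.hom_inv_id

theorem restrict_smul (M : Y.Modules) {U : Y.Opens} (V : (U : Scheme.{u}).Opens)
    (r : Γ(Y, U.ι ''ᵁ V)) (m : Γ(M, U.ι ''ᵁ V)) :
    (show Γ(M, U.ι ''ᵁ V) from (show Γ(U, V) from r) • (show Γ(M.restrict U.ι, V) from m)) =
      r • m := by
  have := Scheme.Modules.smul_restrictAppIso_hom_apply U.ι M V r m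
  rw [Scheme.Opens.ι_appIso] at this
  exact this

theorem IsVectorBundle.exists_isBasis {W : Y.Modules} (hW : IsVectorBundle W) (y : Y) :
    ∃ U : Y.Opens, y ∈ U ∧ ∃ (n : ℕ) (e : Fin n → Γ(W, U)), IsBasis W e := by
  obtain ⟨U, hyU, n, ⟨φ⟩⟩ := hW y
  obtain ⟨e, he⟩ := exists_isBasis_of_iso_free _ n φ
  have hU : U.ι ''ᵁ ⊤ = U := by simp
  -- Sections of the restriction over `⊤` are by definition sections over `U.ι ''ᵁ ⊤`; taking this
  -- open set instead of `U` avoids transporting `e`.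
  refine ⟨U.ι ''ᵁ ⊤, hU.symm ▸ hyU, n, e, fun V h m => ?_⟩
  obtain ⟨V', rfl⟩ : ∃ V' : (U : Scheme.{u}).Opens, V = U.ι ''ᵁ V' :=
    ⟨U.ι ⁻¹ᵁ V, by
      rw [Scheme.Hom.image_preimage_eq_opensRange_inf, Scheme.Opens.opensRange_ι,
        inf_eq_right.mpr (h.trans hU.le)]⟩
  obtain ⟨f, hf, huniq⟩ := he V' le_top m
  refine ⟨f, ?_, fun g hg => huniq g ?_⟩
  · refine Eq.trans ?_ hf
    exact Finset.sum_congr rfl fun i _ => (restrict_smul _ _ _ _).symm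
  · refine Eq.trans ?_ hg
    exact Finset.sum_congr rfl fun i _ => restrict_smul _ _ _ _

theorem IsBasis.restrict {M : Y.Modules} {U V : Y.Opens} {n : ℕ} {e : Fin n → Γ(M, U)}
    (he : IsBasis M e) (h : V ≤ U) : IsBasis M (fun i => res M h (e i)) := by
  intro V' h' m
  simpa only [res_res] using he V' (h'.trans h) m

end Bases

/-! ### Bases of the Frobenius pull-back -/

section PullbackBases

variable {Y : Scheme.{u}}

/-- A morphism of sheaves of modules given by compatible linear maps on sections. -/
def homMk {M N : Y.Modules} (f : ∀ U : Y.Opens, Γ(M, U) →+ Γ(N, U))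
    (hsmul : ∀ (U : Y.Opens) (r : Γ(Y, U)) (m : Γ(M, U)), f U (r • m) = r • f U m)
    (hres : ∀ (U V : Y.Opens) (h : V ≤ U) (m : Γ(M, U)), f V (res M h m) = res N h (f U m)) :
    M ⟶ N where
  val :=
    { app := fun U => ModuleCat.homMk (AddCommGrpCat.ofHom (f U.unop)) fun r => by
        ext m
        exact (hsmul U.unop r m).symm
      naturality := fun {U V} i => by
        ext m
        exact hres U.unop V.unop (leOfHom i.unop) m }

namespace IsBasis

variable {M : Y.Modules} {U : Y.Opens} {n : ℕ} {e : Fin n → Γ(M, U)} (he : IsBasis M e)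

/-- The coordinates of a section with respect to a basis. -/
def coord (he : IsBasis M e) {V : Y.Opens} (h : V ≤ U) (m : Γ(M, V)) : Fin n → Γ(Y, V) :=
  (he V h m).choose

include he in
theorem sum_coord {V : Y.Opens} (h : V ≤ U) (m : Γ(M, V)) :
    ∑ i, he.coord h m i • res M h (e i) = m := (he V h m).choose_spec.1

theorem coord_eq {V : Y.Opens} (h : V ≤ U) {m : Γ(M, V)} {f : Fin n → Γ(Y, V)}
    (hf : ∑ i, f i • res M h (e i) = m) : he.coord h m = f :=
  ((he V h m).choose_spec.2 f hf).symm

theorem coord_add {V : Y.Opens} (h : V ≤ U) (m m' : Γ(M, V)) :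
    he.coord h (m + m') = he.coord h m + he.coord h m' :=
  he.coord_eq h (by simp only [Pi.add_apply, add_smul, Finset.sum_add_distrib, sum_coord])

theorem coord_smul {V : Y.Opens} (h : V ≤ U) (r : Γ(Y, V)) (m : Γ(M, V)) :
    he.coord h (r • m) = r • he.coord h m :=
  he.coord_eq h (by
    simp only [Pi.smul_apply, smul_eq_mul, mul_smul, ← Finset.smul_sum, sum_coord])

theorem coord_res {V V' : Y.Opens} (h : V ≤ U) (h' : V' ≤ V) (m : Γ(M, V)) (i : Fin n) :
    he.coord (h'.trans h) (res M h' m) i = resO h' (he.coord h m i) := by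
  have := he.coord_eq (h'.trans h) (m := res M h' m) (f := fun i => resO h' (he.coord h m i)) (by
    conv_rhs => rw [← he.sum_coord h m]
    simp only [map_sum, res_smul, res_res])
  rw [this]

theorem coord_self {V : Y.Opens} (h : V ≤ U) (i : Fin n) :
    he.coord h (res M h (e i)) = Pi.single i 1 :=
  he.coord_eq h (by
    rw [Finset.sum_eq_single i]
    · simp
    · intro j _ hj
      simp [hj]
    · simp)

end IsBasis

variable (p : ℕ) [Fact p.Prime] [CharP Γ(Y, ⊤) p] (W : Y.Modules)

/-- The Frobenius pull-back of a sheaf of modules. -/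
abbrev frobPullback : Y.Modules := (Scheme.Modules.pullback (absoluteFrobenius p Y)).obj W

/-- The canonical map from the sections of `W` to those of its Frobenius pull-back. -/
def frobUnit (U : Y.Opens) : Γ(W, U) →+ Γ(frobPullback p W, U) :=
  (((Scheme.Modules.pullbackPushforwardAdjunction (absoluteFrobenius p Y)).unit.app W).app U).hom

theorem frobUnit_smul (U : Y.Opens) (f : Γ(Y, U)) (w : Γ(W, U)) :
    frobUnit p W U (f • w) = f ^ p • frobUnit p W U w :=
  Scheme.Modules.Hom.app_smul _ _ _

theorem frobUnit_res {U V : Y.Opens} (h : V ≤ U) (w : Γ(W, U)) :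
    frobUnit p W V (res W h w) = res (frobPullback p W) h (frobUnit p W U w) :=
  app_res ((Scheme.Modules.pullbackPushforwardAdjunction (absoluteFrobenius p Y)).unit.app W) h w

theorem pow_char_add {U : Y.Opens} (a b : Γ(Y, U)) : (a + b) ^ p = a ^ p + b ^ p :=
  map_add (ringFrobenius p _ (natCast_eq_zero p Y (op U))) a b

variable {W} {U : Y.Opens} {n : ℕ} {e : Fin n → Γ(W, U)} (he : IsBasis W e)

/-- The open set `U.ι ''ᵁ U.ι ⁻¹ᵁ V` plays the role of `U ⊓ V`: it is where sections over `V` of a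
direct image along `U.ι` live. -/
theorem image_preimage_le_self (U V : Y.Opens) : U.ι ''ᵁ U.ι ⁻¹ᵁ V ≤ U := by
  rw [Scheme.Hom.image_preimage_eq_opensRange_inf, Scheme.Opens.opensRange_ι]
  exact inf_le_left

theorem le_image_preimage {U V : Y.Opens} (h : V ≤ U) : V ≤ U.ι ''ᵁ U.ι ⁻¹ᵁ V := by
  rw [Scheme.Hom.image_preimage_eq_opensRange_inf, Scheme.Opens.opensRange_ι]
  exact le_inf h le_rfl

/-- The Frobenius-semilinear coordinate functions of a local basis, with values in the direct image
of the structure sheaf of the open subset on which the basis is defined. -/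
def frobCoord (i : Fin n) : W ⟶ (Scheme.Modules.pushforward (absoluteFrobenius p Y)).obj
    ((Scheme.Modules.pushforward U.ι).obj (unitModule U)) :=
  homMk (fun V => AddMonoidHom.mk' (fun w => (show Γ(Y, U.ι ''ᵁ U.ι ⁻¹ᵁ V) from
        (he.coord (image_preimage_le_self U V) (res W (U.ι.image_preimage_le V) w) i) ^ p))
      fun x y => by
        rw [map_add, IsBasis.coord_add]
        exact pow_char_add p _ _)
    (fun V r w => by
      refine (congrArg (fun f => f i ^ p) ((congrArg (he.coord _) (res_smul _ _ _ _)).trans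
        (he.coord_smul _ _ _))).trans ((mul_pow _ _ _).trans ?_)
      exact congrArg (· * _) (map_pow (resO (U.ι.image_preimage_le V)) r p).symm)
    (fun V V' h w => by
      have h' : U.ι ''ᵁ U.ι ⁻¹ᵁ V' ≤ U.ι ''ᵁ U.ι ⁻¹ᵁ V :=
        U.ι.image_mono (U.ι.preimage_mono h)
      have := he.coord_res (image_preimage_le_self U V) h' (res W (U.ι.image_preimage_le V) w) i
      rw [res_res] at this
      have h2 := (congrArg (· ^ p) this).trans (map_pow (resO h') _ p).symm
      rw [← res_res W h (U.ι.image_preimage_le V')] at h2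
      exact h2)

/-- The coordinate functions on the Frobenius pull-back with respect to the pull-back of a basis. -/
def pullbackCoord (i : Fin n) :
    frobPullback p W ⟶ (Scheme.Modules.pushforward U.ι).obj (unitModule U) :=
  ((Scheme.Modules.pullbackPushforwardAdjunction (absoluteFrobenius p Y)).homEquiv _ _).symm
    (frobCoord p he i)

theorem pullbackCoord_frobUnit (i : Fin n) (V : Y.Opens) (w : Γ(W, V)) :
    (pullbackCoord p he i).app V (frobUnit p W V w) = (show Γ(Y, U.ι ''ᵁ U.ι ⁻¹ᵁ V) from
        (he.coord (image_preimage_le_self U V) (res W (U.ι.image_preimage_le V) w) i) ^ p) := by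
  have h := ((Scheme.Modules.pullbackPushforwardAdjunction
    (absoluteFrobenius p Y)).homEquiv_unit (f := pullbackCoord p he i))
  rw [pullbackCoord, Equiv.apply_symm_apply] at h
  exact (congrArg (fun φ => Scheme.Modules.Hom.app φ V w) h).symm

/-- Multiplication of a section over an open subset by functions, as a morphism of modules. -/
def smulSection (M : Y.Modules) (m : Γ(M, U)) :
    (Scheme.Modules.pushforward U.ι).obj (unitModule U) ⟶
      (Scheme.Modules.pushforward U.ι).obj (M.restrict U.ι) :=
  homMk (fun V => AddMonoidHom.mk' (fun f => (show Γ(M, U.ι ''ᵁ U.ι ⁻¹ᵁ V) from HSMul.hSMul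
      (α := Γ(Y, U.ι ''ᵁ U.ι ⁻¹ᵁ V)) (β := Γ(M, U.ι ''ᵁ U.ι ⁻¹ᵁ V)) f
        (res M (image_preimage_le_self U V) m)))
      fun x y => add_smul (R := Γ(Y, U.ι ''ᵁ U.ι ⁻¹ᵁ V))
        (M := Γ(M, U.ι ''ᵁ U.ι ⁻¹ᵁ V)) x y _)
    (fun V r f => by
      refine (mul_smul (α := Γ(Y, U.ι ''ᵁ U.ι ⁻¹ᵁ V)) (β := Γ(M, U.ι ''ᵁ U.ι ⁻¹ᵁ V))
        (resO (U.ι.image_preimage_le V) r) f _).trans ?_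
      exact (restrict_smul M (U.ι ⁻¹ᵁ V) (resO (U.ι.image_preimage_le V) r) _).symm)
    (fun V V' h f => by
      have h' : U.ι ''ᵁ U.ι ⁻¹ᵁ V' ≤ U.ι ''ᵁ U.ι ⁻¹ᵁ V :=
        U.ι.image_mono (U.ι.preimage_mono h)
      refine Eq.trans ?_ (res_smul M h' (show Γ(Y, U.ι ''ᵁ U.ι ⁻¹ᵁ V) from f) _).symm
      rw [res_res]
      rfl)

/-- The coordinate functions on the Frobenius pull-back, on sections. -/
def pullbackCoordApp (i : Fin n) (V : Y.Opens) :
    Γ(frobPullback p W, V) →+ Γ(Y, U.ι ''ᵁ U.ι ⁻¹ᵁ V) :=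
  ((pullbackCoord p he i).app V).hom

theorem pullbackCoordApp_smul (i : Fin n) (V : Y.Opens) (r : Γ(Y, V))
    (m : Γ(frobPullback p W, V)) : pullbackCoordApp p he i V (r • m) =
      resO (U.ι.image_preimage_le V) r * pullbackCoordApp p he i V m :=
  Scheme.Modules.Hom.app_smul (pullbackCoord p he i) r m

/-- By adjunction a morphism out of `F^*W` is determined by its values on the sections `F^*w`. There
the identity is the expansion of `w` in the basis, with coefficients raised to the `p`-th power. -/
theorem sum_pullbackCoord :
    ∑ i, pullbackCoord p he i ≫ smulSection (frobPullback p W) (frobUnit p W U (e i)) =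
      (Scheme.Modules.restrictAdjunction U.ι).unit.app (frobPullback p W) := by
  refine ((Scheme.Modules.pullbackPushforwardAdjunction
    (absoluteFrobenius p Y)).homEquiv _ _).injective ?_
  rw [Adjunction.homEquiv_unit, Adjunction.homEquiv_unit]
  refine Scheme.Modules.hom_ext _ _ fun V => ?_
  ext w
  refine (sum_app _ (fun i => pullbackCoord p he i ≫
    smulSection (frobPullback p W) (frobUnit p W U (e i))) V (frobUnit p W V w)).trans ?_
  have h1 := congrArg (frobUnit p W _)
    (he.sum_coord (image_preimage_le_self U V) (res W (U.ι.image_preimage_le V) w))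
  rw [map_sum, frobUnit_res] at h1
  refine Eq.trans (Finset.sum_congr rfl fun i _ => ?_) h1
  rw [frobUnit_smul, frobUnit_res]
  have h2 := congrArg (fun f => (smulSection (frobPullback p W) (frobUnit p W U (e i))).app V f)
    (pullbackCoord_frobUnit p he i V w)
  exact h2

theorem sum_pullbackCoordApp_smul (V : Y.Opens) (m : Γ(frobPullback p W, V)) :
    ∑ i, pullbackCoordApp p he i V m •
      res (frobPullback p W) (image_preimage_le_self U V) (frobUnit p W U (e i)) =
      res (frobPullback p W) (U.ι.image_preimage_le V) m := by
  have := congrArg (fun φ => Scheme.Modules.Hom.app φ V m) (sum_pullbackCoord p he)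
  exact (sum_app _ (fun i => pullbackCoord p he i ≫
    smulSection (frobPullback p W) (frobUnit p W U (e i))) V m).symm.trans this

theorem pullbackCoordApp_frobUnit {V : Y.Opens} (h : V ≤ U) (i j : Fin n) :
    pullbackCoordApp p he j V (res (frobPullback p W) h (frobUnit p W U (e i))) =
      if i = j then 1 else 0 := by
  rw [← frobUnit_res]
  refine (pullbackCoord_frobUnit p he j V _).trans ?_
  rw [res_res, IsBasis.coord_self, Pi.single_apply]
  split_ifs with h1 h2 h2
  · exact one_pow (M := Γ(Y, U.ι ''ᵁ U.ι ⁻¹ᵁ V)) p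
  · exact absurd h1.symm h2
  · exact absurd h2.symm h1
  · exact zero_pow (M₀ := Γ(Y, U.ι ''ᵁ U.ι ⁻¹ᵁ V)) (Fact.out : p.Prime).ne_zero

include he in
-- The pull-back is reached only through its adjunction, so coordinates are first built as morphisms
-- `pullbackCoord`. Existence is `sum_pullbackCoordApp_smul`; uniqueness holds because these
-- coordinates form a dual basis to the `F^*e_i`.
theorem IsBasis.frobUnit : IsBasis (frobPullback p W) fun i => frobUnit p W U (e i) := by
  intro V h m
  have hle := le_image_preimage h
  refine ⟨fun i => resO hle (pullbackCoordApp p he i V m), ?_, fun f hf => funext fun j => ?_⟩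
  · have := congrArg (res (frobPullback p W) hle) (sum_pullbackCoordApp_smul p he V m)
    simpa only [map_sum, res_smul, res_res, res_self] using this
  · rw [← hf]
    simp only [map_sum, pullbackCoordApp_smul, pullbackCoordApp_frobUnit p he h]
    rw [Finset.sum_eq_single j]
    · simp
    · intro i _ hij
      simp [hij]
    · simp

end PullbackBases

/-! ### The pairing `df ⊗ m` underlying the canonical connection -/

section Pairing

variable {Y : Scheme.{u}}

section Sheafify

variable (P : Y.PresheafOfModules)

/-- The restriction maps of a presheaf of modules. -/
def resP {U V : Y.Opens} (h : V ≤ U) : P.presheaf.obj (op U) →+ P.presheaf.obj (op V) :=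
  (P.presheaf.map (homOfLE h).op).hom

/-- The map from a presheaf of modules to its associated sheaf, on sections. -/
def toSh (U : Y.Opens) : P.presheaf.obj (op U) →+ Γ(sheafify P, U) :=
  ((CategoryTheory.toSheafify (Opens.grothendieckTopology Y) P.presheaf).app (op U)).hom

theorem toSh_res {U V : Y.Opens} (h : V ≤ U) (x : P.presheaf.obj (op U)) :
    toSh P V (resP P h x) = res (sheafify P) h (toSh P U x) :=
  ConcreteCategory.congr_hom ((CategoryTheory.toSheafify (Opens.grothendieckTopology Y)
    P.presheaf).naturality (homOfLE h).op) x

theorem toSh_smul (U : Y.Opens) (r : Γ(Y, U)) (x : P.obj (op U)) :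
    toSh P U (show P.obj (op U) from HSMul.hSMul (α := Y.ringCatSheaf.obj.obj (op U)) r x) =
      r • toSh P U x :=
  (((PresheafOfModules.sheafificationAdjunction (𝟙 Y.ringCatSheaf.obj)).unit.app P).app
    (op U)).hom.map_smul r x

theorem exists_res_eq_zero_of_toSh_eq_zero {U : Y.Opens} {x : P.presheaf.obj (op U)}
    (hx : toSh P U x = 0) {y : Y} (hy : y ∈ U) :
    ∃ (V : Y.Opens) (h : V ≤ U), y ∈ V ∧ resP P h x = 0 := by
  have h0 := Presheaf.equalizerSieve_mem (Opens.grothendieckTopology Y)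
    (CategoryTheory.toSheafify (Opens.grothendieckTopology Y) P.presheaf) x 0
    (hx.trans (map_zero (toSh P U)).symm)
  obtain ⟨V, f, hf, hyV⟩ := h0 y hy
  exact ⟨V, leOfHom f, hyV, hf.trans (map_zero (resP P (leOfHom f)))⟩

end Sheafify

variable (p : ℕ) [Fact p.Prime] [CharP Γ(Y, ⊤) p] (W : Y.Modules)

variable (Y) in
/-- The presheaf of relative differentials of the absolute Frobenius endomorphism. -/
def differentialsPresheaf : Y.PresheafOfModules :=
  PresheafOfModules.DifferentialsConstruction.relativeDifferentials'
    (inverseImageHom (absoluteFrobenius p Y))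

/-- The universal derivation with values in the presheaf of differentials. -/
def preD (U : Y.Opens) : Γ(Y, U) →+ (differentialsPresheaf Y p).presheaf.obj (op U) :=
  AddMonoidHom.mk' (fun f => CommRingCat.KaehlerDifferential.d
    (f := (inverseImageHom (absoluteFrobenius p Y)).app (op U)) f)
    (fun a b => ModuleCat.Derivation.d_add _ a b)

theorem preD_res {U V : Y.Opens} (h : V ≤ U) (f : Γ(Y, U)) :
    preD p V (resO h f) = resP _ h (preD p U f) :=
  (PresheafOfModules.DifferentialsConstruction.relativeDifferentials'_map_d
    (inverseImageHom (absoluteFrobenius p Y)) (homOfLE h).op f).symm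

/-- The sheaf of differentials of the absolute Frobenius endomorphism. -/
abbrev differentials : Y.Modules := relativeDifferentials (absoluteFrobenius p Y)

/-- The universal derivation with values in the sheaf of differentials. -/
def secD (U : Y.Opens) : Γ(Y, U) →+ Γ(differentials (Y := Y) p, U) :=
  (toSh (differentialsPresheaf Y p) U).comp (preD p U)

theorem secD_res {U V : Y.Opens} (h : V ≤ U) (f : Γ(Y, U)) :
    secD p V (resO h f) = res _ h (secD p U f) :=
  (congrArg (toSh _ V) (preD_res p h f)).trans (toSh_res _ h _)

theorem secD_mul {U : Y.Opens} (f g : Γ(Y, U)) :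
    secD p U (f * g) = f • secD p U g + g • secD p U f := by
  refine (congrArg (toSh _ U) (ModuleCat.Derivation.d_mul
    (CommRingCat.KaehlerDifferential.D
      ((inverseImageHom (absoluteFrobenius p Y)).app (op U))) f g)).trans ?_
  refine (map_add (toSh (differentialsPresheaf Y p) U) _ _).trans ?_
  exact congrArg₂ (· + ·) (toSh_smul _ U f _) (toSh_smul _ U g _)

/-- The tensor product of the differentials with the Frobenius pull-back of `W`. -/
abbrev frobForms : Y.Modules := tensor (differentials p) (frobPullback p W)

/-- The presheaf tensor product whose associated sheaf is `frobForms`. -/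
def formsPresheaf : Y.PresheafOfModules :=
  PresheafOfModules.Monoidal.tensorObj (R := Y.presheaf) (differentials (Y := Y) p).val
    (frobPullback p W).val

open TensorProduct in
/-- Pure tensors as sections of the presheaf tensor product. -/
def tmulP (U : Y.Opens) (ω : Γ(differentials (Y := Y) p, U)) (m : Γ(frobPullback p W, U)) :
    (formsPresheaf p W).presheaf.obj (op U) :=
  (show Γ(differentials (Y := Y) p, U) ⊗[Γ(Y, U)] Γ(frobPullback p W, U) from ω ⊗ₜ m)

theorem tmulP_smul (U : Y.Opens) (f : Γ(Y, U)) (ω : Γ(differentials (Y := Y) p, U))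
    (m : Γ(frobPullback p W, U)) : tmulP p W U (f • ω) m = tmulP p W U ω (f • m) :=
  TensorProduct.smul_tmul (R := Γ(Y, U)) f ω m

theorem tmulP_res {U V : Y.Opens} (h : V ≤ U) (ω : Γ(differentials (Y := Y) p, U))
    (m : Γ(frobPullback p W, U)) :
    tmulP p W V (res _ h ω) (res _ h m) = resP _ h (tmulP p W U ω m) := rfl

variable {W} in
-- Contraction with the `j`-th coordinate, `ω ⊗ m ↦ m_j • ω`, sends the sum to `ω j`.
theorem eq_zero_of_sum_tmulP_eq_zero {U : Y.Opens} {n : ℕ} {e : Fin n → Γ(frobPullback p W, U)}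
    (he : IsBasis (frobPullback p W) e) (ω : Fin n → Γ(differentials (Y := Y) p, U))
    (h : ∑ i, tmulP p W U (ω i) (e i) = 0) (j : Fin n) : ω j = 0 := by
  have h' : ∑ i, TensorProduct.tmul Γ(Y, U) (ω i) (e i) = 0 := h
  let φ : Γ(differentials (Y := Y) p, U) →ₗ[Γ(Y, U)] Γ(frobPullback p W, U) →ₗ[Γ(Y, U)]
      Γ(differentials (Y := Y) p, U) :=
    LinearMap.mk₂ Γ(Y, U) (fun ω m => he.coord le_rfl m j • ω)
      (fun _ _ _ => smul_add _ _ _) (fun _ _ _ => smul_comm _ _ _)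
      (fun _ _ _ => by rw [IsBasis.coord_add, Pi.add_apply, add_smul])
      (fun _ _ _ => by rw [IsBasis.coord_smul, Pi.smul_apply, smul_eq_mul, mul_smul])
  have h2 := congrArg (TensorProduct.lift φ) h'
  rw [map_sum, map_zero, Finset.sum_eq_single j] at h2
  · have h3 := he.coord_self le_rfl j
    rw [res_self] at h3
    simpa [φ, h3] using h2
  · intro i _ hij
    have h3 := he.coord_self le_rfl i
    rw [res_self] at h3
    simp [φ, h3, hij]
  · simp

/-- The pairing `(f, m) ↦ df ⊗ m`. -/
def pairing (U : Y.Opens) (f : Γ(Y, U)) (m : Γ(frobPullback p W, U)) : Γ(frobForms p W, U) :=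
  toSh (formsPresheaf p W) U (tmulP p W U (secD p U f) m)

theorem pairing_res {U V : Y.Opens} (h : V ≤ U) (f : Γ(Y, U)) (m : Γ(frobPullback p W, U)) :
    pairing p W V (resO h f) (res _ h m) = res _ h (pairing p W U f m) := by
  rw [pairing, secD_res, tmulP_res]
  exact toSh_res _ h _

theorem pairing_add_left {U : Y.Opens} (f g : Γ(Y, U)) (m : Γ(frobPullback p W, U)) :
    pairing p W U (f + g) m = pairing p W U f m + pairing p W U g m := by
  rw [pairing, map_add]
  exact (congrArg (toSh (formsPresheaf p W) U) (TensorProduct.add_tmul _ _ _)).trans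
    (map_add (toSh (formsPresheaf p W) U) _ _)

theorem pairing_add_right {U : Y.Opens} (f : Γ(Y, U)) (m m' : Γ(frobPullback p W, U)) :
    pairing p W U f (m + m') = pairing p W U f m + pairing p W U f m' :=
  (congrArg (toSh (formsPresheaf p W) U) (TensorProduct.tmul_add _ _ _)).trans
    (map_add (toSh (formsPresheaf p W) U) _ _)

theorem pairing_mul {U : Y.Opens} (f g : Γ(Y, U)) (m : Γ(frobPullback p W, U)) :
    pairing p W U (f * g) m = pairing p W U g (f • m) + pairing p W U f (g • m) := by
  rw [pairing, secD_mul]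
  refine (congrArg (toSh (formsPresheaf p W) U) (TensorProduct.add_tmul _ _ _)).trans
    ((map_add (toSh (formsPresheaf p W) U) _ _).trans ?_)
  exact congrArg₂ (· + ·)
    (congrArg (toSh (formsPresheaf p W) U) (tmulP_smul p W U f (secD p U g) m))
    (congrArg (toSh (formsPresheaf p W) U) (tmulP_smul p W U g (secD p U f) m))

/-- The pairing as a biadditive map. -/
def pairingHom (U : Y.Opens) : Γ(Y, U) →+ Γ(frobPullback p W, U) →+ Γ(frobForms p W, U) :=
  AddMonoidHom.mk' (fun f => AddMonoidHom.mk' (pairing p W U f) (pairing_add_right p W f))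
    fun f g => AddMonoidHom.ext (pairing_add_left p W f g)

theorem pairing_sum_right {U : Y.Opens} {ι : Type*} (s : Finset ι) (f : Γ(Y, U))
    (m : ι → Γ(frobPullback p W, U)) :
    pairing p W U f (∑ i ∈ s, m i) = ∑ i ∈ s, pairing p W U f (m i) :=
  map_sum (pairingHom p W U f) m s

theorem pairing_sum_left {U : Y.Opens} {ι : Type*} (s : Finset ι) (f : ι → Γ(Y, U))
    (m : Γ(frobPullback p W, U)) :
    pairing p W U (∑ i ∈ s, f i) m = ∑ i ∈ s, pairing p W U (f i) m :=
  map_sum ((pairingHom p W U).flip m) f s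

theorem pairing_neg_left {U : Y.Opens} (f : Γ(Y, U)) (m : Γ(frobPullback p W, U)) :
    pairing p W U (-f) m = -pairing p W U f m :=
  map_neg ((pairingHom p W U).flip m) f

theorem pairing_pow {U : Y.Opens} (f : Γ(Y, U)) (m : Γ(frobPullback p W, U)) (k : ℕ) :
    pairing p W U (f ^ (k + 1)) m = pairing p W U f (((k + 1 : ℕ) * f ^ k) • m) := by
  induction k generalizing m with
  | zero => simp
  | succ k ih =>
    rw [pow_succ f (k + 1), pairing_mul, ih, ← pairing_add_right, smul_smul, ← add_smul]
    congr 2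
    push_cast
    ring

theorem pairing_pow_char {U : Y.Opens} (f : Γ(Y, U)) (m : Γ(frobPullback p W, U)) :
    pairing p W U (f ^ p) m = 0 := by
  obtain ⟨k, hk⟩ := Nat.exists_eq_succ_of_ne_zero (Fact.out : p.Prime).ne_zero
  have h : ((k + 1 : ℕ) : Γ(Y, U)) = 0 := by
    rw [← Nat.succ_eq_add_one, ← hk]
    exact natCast_eq_zero p Y (op U)
  have h2 := pairing_pow p W f m k
  rw [h, zero_mul, zero_smul] at h2
  rw [show f ^ p = f ^ (k + 1) from congrArg (f ^ ·) hk]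
  exact h2.trans (map_zero (pairingHom p W U f))

/-- The differential is linear over `p`-th powers. This lets the coefficients of a pulled-back
section move across the tensor sign and under `d`. -/
theorem pairing_pow_char_mul {U : Y.Opens} (a f : Γ(Y, U)) (m : Γ(frobPullback p W, U)) :
    pairing p W U (f * a ^ p) m = pairing p W U f (a ^ p • m) := by
  rw [pairing_mul, pairing_pow_char, zero_add]

/-! ### Vanishing differentials at the generic point -/

section Nondegenerate

/-- Frobenius is the identity on the space, so direct image is the identity functor and the unit of
the adjunction is an isomorphism. Sections of the inverse image are thus sections of the structure
sheaf, on which the map is `g ↦ g ^ p`. -/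
theorem exists_inverseImageHom_eq_pow (U : Y.Opens)
    (a : ((TopCat.Presheaf.pullback CommRingCat.{u} (absoluteFrobenius p Y).base).obj
      Y.presheaf).obj (op U)) :
    ∃ g : Γ(Y, U), (inverseImageHom (absoluteFrobenius p Y)).app (op U) a = g ^ p := by
  let adj := TopCat.Presheaf.pullbackPushforwardAdjunction CommRingCat.{u}
    (absoluteFrobenius p Y).base
  have : (TopCat.Presheaf.pushforward CommRingCat.{u} (absoluteFrobenius p Y).base).IsEquivalence :=
    inferInstanceAs (𝟭 (TopCat.Presheaf CommRingCat.{u} Y)).IsEquivalence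
  have : IsIso (adj.unit.app Y.presheaf) := inferInstance
  have happ : IsIso ((adj.unit.app Y.presheaf).app (op U)) := inferInstance
  obtain ⟨g, rfl⟩ : ∃ g : Γ(Y, U), (adj.unit.app Y.presheaf).app (op U) g = a :=
    (ConcreteCategory.bijective_of_isIso ((adj.unit.app Y.presheaf).app (op U))).2 a
  refine ⟨g, ?_⟩
  have h := adj.homEquiv_unit (f := inverseImageHom (absoluteFrobenius p Y))
  have h2 : adj.homEquiv _ _ (inverseImageHom (absoluteFrobenius p Y)) =
      (absoluteFrobenius p Y).c := Equiv.apply_symm_apply _ _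
  rw [h2] at h
  exact (ConcreteCategory.congr_hom (NatTrans.congr_app h (op U)) g).symm

/-- If the germ of `f` were not a `p`-th power, it would have nonzero differential over some
subfield `E` containing all `p`-th powers. Since the base ring of the differentials maps into `E`,
functoriality sends `df = 0` to that nonzero differential. -/
theorem exists_pow_eq_of_preD_eq_zero [IsIntegral Y] {U : Y.Opens} (hU : genericPoint Y ∈ U)
    (f : Γ(Y, U)) (hf : preD p U f = 0) :
    ∃ z : Y.functionField, z ^ p = Y.presheaf.germ U (genericPoint Y) hU f := by
  by_contra! hx
  let θ : Y.presheaf.obj (op U) ⟶ Y.functionField := Y.presheaf.germ U (genericPoint Y) hU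
  have hp0 : (p : Y.functionField) = 0 := by
    have h := congrArg θ.hom (natCast_eq_zero p Y (op U))
    rwa [map_natCast, map_zero] at h
  obtain ⟨E, hE, hD⟩ := exists_subfield_D_ne_zero p hp0 (θ.hom f) hx
  let φ := (inverseImageHom (absoluteFrobenius p Y)).app (op U)
  let g : _ ⟶ CommRingCat.of E := CommRingCat.ofHom ((φ ≫ θ).hom.codRestrict E.toSubring fun a => by
    obtain ⟨b, hb⟩ := exists_inverseImageHom_eq_pow p U a
    have : (φ ≫ θ).hom a = (θ.hom b) ^ p := by
      rw [← map_pow]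
      exact congrArg θ.hom hb
    rw [this]
    exact hE _)
  let ι : CommRingCat.of E ⟶ Y.functionField := CommRingCat.ofHom E.subtype
  have fac : g ≫ ι = φ ≫ θ := by
    ext a
    rfl
  have h := CommRingCat.KaehlerDifferential.map_d fac f
  have h0 : CommRingCat.KaehlerDifferential.d (f := φ) f = 0 := hf
  rw [h0, map_zero] at h
  exact hD h.symm

variable {W} in
-- The open set is shrunk around the generic point twice, since both the tensor product and the
-- differentials are associated sheaves and vanishing holds in the presheaf only locally.
theorem exists_pow_eq_of_sum_pairing_eq_zero [IsIntegral Y] {U : Y.Opens}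
    (hU : genericPoint Y ∈ U) {n : ℕ} {e : Fin n → Γ(frobPullback p W, U)}
    (he : IsBasis (frobPullback p W) e) (f : Fin n → Γ(Y, U))
    (h : ∑ i, pairing p W U (f i) (e i) = 0) (j : Fin n) :
    ∃ z : Y.functionField, z ^ p = Y.presheaf.germ U (genericPoint Y) hU (f j) := by
  have h1 : toSh (formsPresheaf p W) U (∑ i, tmulP p W U (secD p U (f i)) (e i)) = 0 := by
    rw [map_sum]
    exact h
  obtain ⟨V, hVU, hV, h2⟩ := exists_res_eq_zero_of_toSh_eq_zero _ h1 hU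
  rw [map_sum] at h2
  have h3 := eq_zero_of_sum_tmulP_eq_zero p (he.restrict hVU)
    (fun i => res _ hVU (secD p U (f i))) h2 j
  rw [← secD_res] at h3
  obtain ⟨V', hV', hη, h4⟩ := exists_res_eq_zero_of_toSh_eq_zero (differentialsPresheaf Y p) h3 hV
  rw [← preD_res] at h4
  obtain ⟨z, hz⟩ := exists_pow_eq_of_preD_eq_zero p hη _ h4
  refine ⟨z, hz.trans ?_⟩
  rw [resO_resO]
  exact TopCat.Presheaf.germ_res_apply Y.presheaf (homOfLE (hV'.trans hVU)) _ hη (f j)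

end Nondegenerate

end Pairing

/-! ### Cokernels and cohomology, roots on normal schemes, independence of the basis -/

section Cohomology

variable {Y : Scheme.{u}}

/-- If the cokernel of a monomorphism of abelian sheaves has no nonzero global sections, then the
induced map on the first cohomology groups is injective. -/
theorem injective_H_map_one {F G : Sheaf (Opens.grothendieckTopology Y) AddCommGrpCat.{u}}
    (f : F ⟶ G) [Mono f]
    (h : Subsingleton ((Limits.cokernel f).obj.obj (op (⊤ : Y.Opens)))) :
    Function.Injective (Sheaf.H.map.{u} f 1) := by
  rw [injective_iff_map_eq_zero]
  intro x hx
  have hS : (ShortComplex.mk f (Limits.cokernel.π f) (Limits.cokernel.condition f)).ShortExact :=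
    { exact := ShortComplex.exact_cokernel f }
  -- A class killed in `H^1(G)` is the connecting image of a global section of the cokernel.
  obtain ⟨x₃, rfl⟩ := Abelian.Ext.covariant_sequence_exact₁ _ hS x hx (zero_add 1)
  have h2 : x₃ = 0 := by
    refine (Sheaf.H.equiv₀ (J := Opens.grothendieckTopology Y) (Limits.cokernel f)
      Limits.isTerminalTop).injective ?_
    exact Subsingleton.elim _ _
  rw [h2, Abelian.Ext.zero_comp]

theorem exists_app_eq_of_cokernel_eq_zero {F G : Sheaf (Opens.grothendieckTopology Y) AddCommGrpCat.{u}}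
    (f : F ⟶ G)
    [Mono f] {U : Y.Opens} (s : G.obj.obj (op U))
    (hs : (Limits.cokernel.π f).hom.app (op U) s = 0) :
    ∃ t : F.obj.obj (op U), f.hom.app (op U) t = s := by
  let S := ShortComplex.mk f (Limits.cokernel.π f) (Limits.cokernel.condition f)
  have hS : S.Exact := ShortComplex.exact_cokernel f
  let E : Sheaf (Opens.grothendieckTopology Y) AddCommGrpCat.{u} ⥤ AddCommGrpCat.{u} :=
    sheafToPresheaf _ _ ⋙ (evaluation _ _).obj (op U)
  have : E.Additive := inferInstance
  have h := hS.map_of_mono_of_preservesKernel E (inferInstanceAs (Mono f)) inferInstance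
  rw [ShortComplex.ab_exact_iff] at h
  exact h s hs

theorem exists_cokernel_lift {F G : Sheaf (Opens.grothendieckTopology Y) AddCommGrpCat.{u}}
    (f : F ⟶ G)
    {U : Y.Opens} (q : (Limits.cokernel f).obj.obj (op U)) {y : Y} (hy : y ∈ U) :
    ∃ (V : Y.Opens) (h : V ≤ U) (s : G.obj.obj (op V)), y ∈ V ∧
      (Limits.cokernel.π f).hom.app (op V) s = (Limits.cokernel f).obj.map (homOfLE h).op q := by
  have : Sheaf.IsLocallySurjective (Limits.cokernel.π f) :=
    (Sheaf.isLocallySurjective_iff_epi' (A := AddCommGrpCat.{u}) _).mpr inferInstance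
  have h := Presheaf.imageSieve_mem (Opens.grothendieckTopology Y) (Limits.cokernel.π f).hom q
  obtain ⟨V, i, ⟨s, hs⟩, hyV⟩ := h y hy
  exact ⟨V, leOfHom i, s, hyV, hs⟩

theorem eq_of_locally_res_eq (M : Y.Modules) {U : Y.Opens} (s t : Γ(M, U))
    (h : ∀ y ∈ U, ∃ (V : Y.Opens) (hV : V ≤ U), y ∈ V ∧ res M hV s = res M hV t) : s = t := by
  choose! V hV hy heq using h
  exact TopCat.Sheaf.eq_of_locally_eq' ⟨M.presheaf, M.isSheaf⟩ (fun y : U => V y) U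
    (fun y => homOfLE (hV y y.2)) (fun y hyU => Opens.mem_iSup.mpr ⟨⟨y, hyU⟩, hy y hyU⟩) s t
    fun y => heq y y.2

/-- The root `z` is integral over the stalk at `y`, since `z ^ p` lies in it. The stalk is
integrally closed in the function field, so `z` is a germ at `y`, and the equation of germs spreads
to a neighbourhood. -/
theorem exists_germ_pow_eq [IsIntegral Y] (hY : IsNormal Y) {p : ℕ} (hp : 0 < p) {U : Y.Opens}
    (hU : genericPoint Y ∈ U) (f : Γ(Y, U)) (z : Y.functionField)
    (hz : z ^ p = Y.presheaf.germ U (genericPoint Y) hU f) {y : Y} (hy : y ∈ U) :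
    ∃ (V : Y.Opens) (h : V ≤ U) (g : Γ(Y, V)), y ∈ V ∧ g ^ p = resO h f := by
  obtain ⟨_, _⟩ := hY y
  have hgerm : algebraMap (Y.presheaf.stalk y) Y.functionField (Y.presheaf.germ U y hy f) =
      Y.presheaf.germ U (genericPoint Y) hU f :=
    ConcreteCategory.congr_hom (Y.presheaf.germ_stalkSpecializes hy _) f
  obtain ⟨x, hx⟩ := IsIntegrallyClosed.exists_algebraMap_eq_of_isIntegral_pow
    (R := Y.presheaf.stalk y) (K := Y.functionField) (x := z) hp (by
      rw [hz, ← hgerm]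
      exact isIntegral_algebraMap)
  have hxp : x ^ p = Y.presheaf.germ U y hy f := by
    refine IsFractionRing.injective (Y.presheaf.stalk y) Y.functionField ?_
    rw [map_pow, hx, hz, hgerm]
  obtain ⟨V, hyV, g, rfl⟩ := Y.presheaf.exists_germ_eq (x := y) x
  have hxp' : Y.presheaf.germ V y hyV (g ^ p) = Y.presheaf.germ U y hy f := by
    rw [← hxp, map_pow]
  obtain ⟨V', hyV', i, j, h⟩ := Y.presheaf.germ_eq y hyV hy _ _ hxp'
  exact ⟨V', leOfHom j, resO (leOfHom i) g, hyV', by rw [← map_pow]; exact h⟩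

variable (p : ℕ) [Fact p.Prime] [CharP Γ(Y, ⊤) p] {W : Y.Modules}

/-- In local bases the map raises coordinates to the `p`-th power, and the structure sheaf has no
nilpotents. -/
theorem frobUnit_injective [IsIntegral Y] (hW : IsVectorBundle W) (U : Y.Opens) :
    Function.Injective (frobUnit p W U) := by
  rw [injective_iff_map_eq_zero]
  intro w hw
  refine eq_of_locally_res_eq W _ _ fun y hy => ?_
  obtain ⟨U', hyU', n, e, he⟩ := hW.exists_isBasis y
  refine ⟨U ⊓ U', inf_le_left, ⟨hy, hyU'⟩, ?_⟩
  rw [map_zero, ← he.sum_coord inf_le_right (res W inf_le_left w)]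
  have h1 := congrArg (res (frobPullback p W) (inf_le_left : U ⊓ U' ≤ U)) hw
  rw [← frobUnit_res, ← he.sum_coord inf_le_right (res W inf_le_left w), map_sum, map_zero] at h1
  simp only [frobUnit_smul, frobUnit_res] at h1
  have h2 := ((he.frobUnit p) _ inf_le_right 0).unique h1 (y₂ := 0) (by simp)
  have : Nonempty (U ⊓ U' : Y.Opens) := ⟨⟨y, hy, hyU'⟩⟩
  refine Finset.sum_eq_zero fun i _ => ?_
  have h3 := congrFun h2 i
  rw [pow_eq_zero_iff (Fact.out : p.Prime).ne_zero |>.mp h3, zero_smul]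

/-- This is the well-definedness of the connection. With `w_i = ∑ c_ij e_j` locally, the relation
says `∑_i f_i c_ij^p = 0` for each `j`, and the `j`-th coefficient of the sum is `∑_i c_ij^p df_i =
d(∑_i f_i c_ij^p) = 0`. -/
theorem sum_pairing_eq_zero (hW : IsVectorBundle W) {U : Y.Opens} {ι : Type*} [Fintype ι]
    (f : ι → Γ(Y, U)) (w : ι → Γ(W, U)) (h : ∑ i, f i • frobUnit p W U (w i) = 0) :
    ∑ i, pairing p W U (f i) (frobUnit p W U (w i)) = 0 := by
  refine eq_of_locally_res_eq _ _ _ fun y hy => ?_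
  obtain ⟨U', hyU', n, e, he⟩ := hW.exists_isBasis y
  refine ⟨U ⊓ U', inf_le_left, ⟨hy, hyU'⟩, ?_⟩
  have hl : U ⊓ U' ≤ U := inf_le_left
  have hr : U ⊓ U' ≤ U' := inf_le_right
  let c (i : ι) : Fin n → Γ(Y, U ⊓ U') := he.coord hr (res W hl (w i))
  have hw (i : ι) : res (frobPullback p W) hl (frobUnit p W U (w i)) =
      ∑ j, c i j ^ p • res (frobPullback p W) hr (frobUnit p W U' (e j)) := by
    rw [← frobUnit_res, ← he.sum_coord hr (res W hl (w i)), map_sum]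
    simp only [frobUnit_smul, frobUnit_res, c]
  have h1 := congrArg (res (frobPullback p W) hl) h
  rw [map_sum, map_zero] at h1
  simp only [res_smul, hw, Finset.smul_sum, smul_smul] at h1
  rw [Finset.sum_comm] at h1
  simp only [← Finset.sum_smul] at h1
  have h2 := ((he.frobUnit p) _ hr 0).unique h1 (y₂ := 0) (by simp)
  rw [map_sum, map_zero]
  simp only [← pairing_res, hw, pairing_sum_right, ← pairing_pow_char_mul]
  rw [Finset.sum_comm]
  simp only [← pairing_sum_left]
  refine Finset.sum_eq_zero fun j _ => ?_
  rw [congrFun h2 j]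
  exact DFunLike.congr_fun (map_zero (pairingHom p W (U ⊓ U'))) _

end Cohomology

/-! ### Vanishing of global sections of the cokernel -/

section Cokernel

variable {Y : Scheme.{u}} (p : ℕ) [Fact p.Prime] [CharP Γ(Y, ⊤) p] (W : Y.Modules)

/-- The cokernel of `W ⟶ F_Y^* W` as a sheaf of abelian groups. -/
abbrev frobCokernel : Sheaf (Opens.grothendieckTopology Y) AddCommGrpCat.{u} :=
  Limits.cokernel (toFrobeniusPullback p Y W)

/-- The projection onto the cokernel, on sections. -/
def frobProj (U : Y.Opens) : Γ(frobPullback p W, U) →+ (frobCokernel p W).obj.obj (op U) :=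
  ((Limits.cokernel.π (toFrobeniusPullback p Y W)).hom.app (op U)).hom

/-- The restriction maps of the cokernel. -/
def resCokernel {U V : Y.Opens} (h : V ≤ U) :
    (frobCokernel p W).obj.obj (op U) →+ (frobCokernel p W).obj.obj (op V) :=
  ((frobCokernel p W).obj.map (homOfLE h).op).hom

theorem frobProj_res {U V : Y.Opens} (h : V ≤ U) (s : Γ(frobPullback p W, U)) :
    frobProj p W V (res _ h s) = resCokernel p W h (frobProj p W U s) :=
  ConcreteCategory.congr_hom
    ((Limits.cokernel.π (toFrobeniusPullback p Y W)).hom.naturality (homOfLE h).op) s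

theorem resCokernel_resCokernel {U V V' : Y.Opens} (h : V ≤ U) (h' : V' ≤ V)
    (q : (frobCokernel p W).obj.obj (op U)) :
    resCokernel p W h' (resCokernel p W h q) = resCokernel p W (h'.trans h) q :=
  (ConcreteCategory.congr_hom
    ((frobCokernel p W).obj.map_comp (homOfLE h).op (homOfLE h').op) q).symm

theorem frobProj_frobUnit (U : Y.Opens) (w : Γ(W, U)) :
    frobProj p W U (frobUnit p W U w) = 0 :=
  congrArg (fun φ : (SheafOfModules.toSheaf Y.ringCatSheaf).obj W ⟶ frobCokernel p W =>
    φ.hom.app (op U) w) (Limits.cokernel.condition (toFrobeniusPullback p Y W))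

variable {W}

theorem mono_toFrobeniusPullback [IsIntegral Y] (hW : IsVectorBundle W) :
    Mono (toFrobeniusPullback p Y W) :=
  Sheaf.mono_of_injective _ fun U => frobUnit_injective p hW U.unop

/-- Every section of the cokernel is locally given by coordinates with respect to a basis. -/
theorem exists_local_coordinates (hW : IsVectorBundle W)
    (q : (frobCokernel p W).obj.obj (op (⊤ : Y.Opens))) (y : Y) :
    ∃ (V : Y.Opens) (n : ℕ) (e : Fin n → Γ(W, V)) (f : Fin n → Γ(Y, V)), y ∈ V ∧ IsBasis W e ∧
      frobProj p W V (∑ i, f i • frobUnit p W V (e i)) = resCokernel p W le_top q := by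
  obtain ⟨U, hyU, n, e, he⟩ := hW.exists_isBasis y
  obtain ⟨V, hV, s, hyV, hs⟩ : ∃ (V : Y.Opens) (hV : V ≤ ⊤) (s : Γ(frobPullback p W, V)),
      y ∈ V ∧ frobProj p W V s = resCokernel p W hV q :=
    exists_cokernel_lift (toFrobeniusPullback p Y W) q trivial
  have hl : V ⊓ U ≤ V := inf_le_left
  have hr : V ⊓ U ≤ U := inf_le_right
  have he' := (he.restrict hr).frobUnit p
  refine ⟨V ⊓ U, n, _, he'.coord le_rfl (res (frobPullback p W) hl s), ⟨hyV, hyU⟩,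
    he.restrict hr, ?_⟩
  have h1 := he'.sum_coord le_rfl (res (frobPullback p W) hl s)
  simp only [res_self] at h1
  rw [h1, frobProj_res]
  rw [hs, resCokernel_resCokernel]

theorem cokernel_section_eq_zero [IsIntegral Y] (hY : IsNormal Y) (hW : IsVectorBundle W)
    (h : genericGlobalSections (frobForms p W) = ⊥)
    (q : (frobCokernel p W).obj.obj (op (⊤ : Y.Opens))) : q = 0 := by
  have := mono_toFrobeniusPullback p hW
  choose V n e f hyV he hq using exists_local_coordinates p hW q
  -- `s y` is a local lift of `q`, and `t y` is its derivative under the connection.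
  let s (y : Y) : Γ(frobPullback p W, V y) := ∑ i, f y i • frobUnit p W (V y) (e y i)
  let t (y : Y) : Γ(frobForms p W, V y) :=
    ∑ i, pairing p W (V y) (f y i) (frobUnit p W (V y) (e y i))
  have hcompat (y z : Y) :
      res (frobForms p W) (inf_le_left : V y ⊓ V z ≤ V y) (t y) =
        res (frobForms p W) (inf_le_right : V y ⊓ V z ≤ V z) (t z) := by
    have hl : V y ⊓ V z ≤ V y := inf_le_left
    have hr : V y ⊓ V z ≤ V z := inf_le_right
    obtain ⟨w, hw⟩ : ∃ w : Γ(W, V y ⊓ V z), frobUnit p W (V y ⊓ V z) w =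
        res (frobPullback p W) hl (s y) - res (frobPullback p W) hr (s z) :=
      exists_app_eq_of_cokernel_eq_zero (toFrobeniusPullback p Y W) _ (by
        change frobProj p W _ (_ - _) = 0
        rw [map_sub, frobProj_res, frobProj_res, hq, hq, resCokernel_resCokernel,
          resCokernel_resCokernel, sub_self])
    -- The relation `s y - s z - F^*w = 0` is written as one family in three blocks. The coefficient
    -- of `-w` is given as `1 ^ p` so that `pairing_pow_char` removes its term.
    have key := sum_pairing_eq_zero p hW
      (Sum.elim (fun i => resO hl (f y i)) (Sum.elim (fun i => -resO hr (f z i))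
        (fun _ : Unit => 1 ^ p)))
      (Sum.elim (fun i => res W hl (e y i)) (Sum.elim (fun i => res W hr (e z i))
        (fun _ : Unit => -w))) (by
        simp only [Fintype.sum_sum_type, Sum.elim_inl, Sum.elim_inr, frobUnit_res, ← res_smul,
          neg_smul, Finset.sum_neg_distrib, ← map_sum]
        simp [hw, s]
        abel)
    simp only [Fintype.sum_sum_type, Sum.elim_inl, Sum.elim_inr, frobUnit_res, pairing_res,
      pairing_neg_left, Finset.sum_neg_distrib, ← map_sum, pairing_pow_char,
      Finset.sum_const_zero, add_zero] at key
    exact eq_of_sub_eq_zero ((sub_eq_add_neg _ _).trans key)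
  obtain ⟨t₀, ht₀, -⟩ := TopCat.Sheaf.existsUnique_gluing'
    ⟨(frobForms p W).presheaf, (frobForms p W).isSheaf⟩ V ⊤ (fun y => homOfLE le_top)
    (fun y _ => Opens.mem_iSup.mpr ⟨y, hyV y⟩) t hcompat
  have hgerm : (frobForms p W).presheaf.germ ⊤ (genericPoint Y) trivial t₀ = 0 := by
    have : (frobForms p W).presheaf.germ ⊤ (genericPoint Y) trivial t₀ ∈
      genericGlobalSections (frobForms p W) := ⟨t₀, rfl⟩
    rwa [h] at this
  have hη (y : Y) : genericPoint Y ∈ V y :=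
    ((genericPoint_spec Y).specializes trivial).mem_open (V y).isOpen (hyV y)
  -- The glued section `t₀` has zero generic germ, so every `t y` vanishes near the generic point.
  have hroot (y : Y) (i : Fin (n y)) :
      ∃ z : Y.functionField, z ^ p = Y.presheaf.germ (V y) (genericPoint Y) (hη y) (f y i) := by
    have h1 : (frobForms p W).presheaf.germ (V y) (genericPoint Y) (hη y) (t y) =
        (frobForms p W).presheaf.germ (V y) (genericPoint Y) (hη y) 0 := by
      rw [map_zero, ← hgerm, ← ht₀ y]
      exact TopCat.Presheaf.germ_res_apply _ _ _ _ _
    obtain ⟨V', hηV', j, _, h2⟩ := TopCat.Presheaf.germ_eq _ _ _ _ _ _ h1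
    have h3 : res (frobForms p W) (leOfHom j) (t y) = 0 := h2.trans (map_zero _)
    simp only [t, map_sum, ← pairing_res, ← frobUnit_res] at h3
    obtain ⟨z, hz⟩ := exists_pow_eq_of_sum_pairing_eq_zero p hηV'
      (((he y).restrict (leOfHom j)).frobUnit p) (fun i => resO (leOfHom j) (f y i)) h3 i
    exact ⟨z, hz.trans (TopCat.Presheaf.germ_res_apply Y.presheaf _ _ hηV' (f y i))⟩
  refine TopCat.Presheaf.section_ext (frobCokernel p W) ⊤ q 0 fun y _ => ?_
  have hres {U V : Y.Opens} (hVU : V ≤ U) (hy : y ∈ V) (c : (frobCokernel p W).obj.obj (op U)) :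
      (TopCat.Sheaf.presheaf (frobCokernel p W)).germ V y hy (resCokernel p W hVU c) =
        (TopCat.Sheaf.presheaf (frobCokernel p W)).germ U y (hVU hy) c :=
    TopCat.Presheaf.germ_res_apply _ (homOfLE hVU) y hy c
  rw [map_zero, ← hres le_top (hyV y) q, ← hq, map_sum, map_sum]
  refine Finset.sum_eq_zero fun i _ => ?_
  -- Near `y` the coefficient is `g ^ p`, so its term is the image of `g • e y i` and dies in the
  -- cokernel.
  obtain ⟨z, hz⟩ := hroot y i
  obtain ⟨V', hV', g, hyV', hg⟩ := exists_germ_pow_eq hY (Fact.out : p.Prime).pos (hη y) (f y i) z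
    hz (hyV y)
  rw [← hres hV' hyV', ← frobProj_res, res_smul, ← hg, ← frobUnit_res, ← frobUnit_smul,
    frobProj_frobUnit, map_zero]

end Cokernel

end FrobeniusH1

end

theorem corollary2p2 (p : ℕ) [Fact p.Prime] (Y : Scheme.{u}) [IsIntegral Y]
    [CharP Γ(Y, ⊤) p] (hY : FrobeniusH1.IsNormal Y)
    (W : Y.Modules) (hW : FrobeniusH1.IsVectorBundle W)
    (h : FrobeniusH1.genericGlobalSections
      (FrobeniusH1.tensor
        (FrobeniusH1.relativeDifferentials (FrobeniusH1.absoluteFrobenius p Y))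
        ((Scheme.Modules.pullback (FrobeniusH1.absoluteFrobenius p Y)).obj W)) = ⊥) :
    Function.Injective (FrobeniusH1.frobeniusPullback p Y W 1) := by
  have := FrobeniusH1.mono_toFrobeniusPullback p hW
  refine FrobeniusH1.injective_H_map_one _ (subsingleton_of_forall_eq 0 fun q => ?_)
  exact FrobeniusH1.cokernel_section_eq_zero p hY hW h q
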